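/- For $n\ge 2$ and a nonempty $\mathcal D\subsetneq\{0,\dots,n-1\}^2$, the fractal square with digit set $\mathcal D$ is the unique nonempty compact set $F\subset\mathbb R^2$ with $F=\frac1n(F+\mathcal D)$. Let $F_6$ and $F_9$ be the fractal squares with $n=3$ and digit sets $$\mathcal D_6=\{(0,0),(1,0),(2,0),(1,1),(1,2)\},\qquad \mathcal D_9=\{(0,0),(2,0),(1,1),(0,2),(2,2)\},$$ that is, with label matrices $$M_6=\begin{bmatrix}0&1&0\\0&1&0\\1&1&1\end{bmatrix},\qquad M_9=\begin{bmatrix}1&0&1\\0&1&0\\1&0&1\end{bmatrix},$$ where the entry in row $i$ and column $j$ ($1\le i,j\le 3$) is $1$ if $(j-1,3-i)\in\mathcal D$ and $0$ otherwise. A point $a$ of a nonempty connected set $E\subset\mathbb R^2$ is a $k$-branch point of $E$ if $E\setminus\{a\}$ has exactly $k$ connected components. Two sets $E,F\subset\mathbb R^2$ are Lipschitz equivalent if there are a bijection $g:E\to F$ and a constant $C>0$ with $C^{-1}|x-y|\le|g(x)-g(y)|\le C|x-y|$ for all $x,y\in E$. Theorem. The sets $F_6$ and $F_9$ are connected; $F_6$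 has a $3$-branch point, while $F_9$ has no $3$-branch point. Moreover $F_6$ and $F_9$ are not homeomorphic, hence not Lipschitz equivalent. -/

import Mathlib

/-- The Euclidean plane. -/
abbrev Plane : Type := EuclideanSpace ℝ (Fin 2)

/-- A digit `d = (a, b)` in `{0, …, n - 1}²`, as a vector of the plane. -/
noncomputable def digitVec {n : ℕ} (d : Fin n × Fin n) : Plane :=
  !₂[((d.1 : ℕ) : ℝ), ((d.2 : ℕ) : ℝ)]

/-- The contraction `S_d (x) = (x + d) / n` of the iterated function system. -/
noncomputable def digitMap {n : ℕ} (d : Fin n × Fin n) (x : Plane) : Plane :=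
  (n : ℝ)⁻¹ • (x + digitVec d)

/-- `F` is a nonempty compact set with `F = ⋃_{d ∈ D} S_d (F) = (F + D) / n`. -/
def IsFractalSquare {n : ℕ} (D : Finset (Fin n × Fin n)) (F : Set Plane) : Prop :=
  F.Nonempty ∧ IsCompact F ∧ F = ⋃ d ∈ D, digitMap d '' F

/-- The fractal square with digit set `D ⊆ {0, …, n - 1}²`: the set of all sums
`∑_{k ≥ 1} n⁻ᵏ d_k` with digits `d_k ∈ D`. By `isFractalSquare_iff` below it is the unique
nonempty compact set `F` with `F = (F + D) / n` (for `n ≥ 2` and `D` nonempty). -/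
noncomputable def fractalSquare {n : ℕ} (D : Finset (Fin n × Fin n)) : Set Plane :=
  {x | ∃ w : ℕ → Fin n × Fin n, (∀ k, w k ∈ D) ∧
    HasSum (fun k : ℕ => ((n : ℝ)⁻¹) ^ (k + 1) • digitVec (w k)) x}

lemma norm_digitVec_le {n : ℕ} (d : Fin n × Fin n) : ‖digitVec d‖ ≤ 2 * n := by
  have h1 : ((d.1 : ℕ) : ℝ) ≤ n := by exact_mod_cast d.1.2.le
  have h2 : ((d.2 : ℕ) : ℝ) ≤ n := by exact_mod_cast d.2.2.le
  have h3 : (0 : ℝ) ≤ ((d.1 : ℕ) : ℝ) := by positivity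
  have h4 : (0 : ℝ) ≤ ((d.2 : ℕ) : ℝ) := by positivity
  rw [EuclideanSpace.norm_eq]
  apply Real.sqrt_le_iff.2
  refine ⟨by positivity, ?_⟩
  simp only [digitVec, Fin.sum_univ_two, Real.norm_eq_abs, sq_abs]
  simp
  nlinarith

lemma norm_digit_term_le {n : ℕ} (w : Fin n × Fin n) (k : ℕ) :
    ‖((n : ℝ)⁻¹) ^ (k + 1) • digitVec w‖ ≤ ((n : ℝ)⁻¹) ^ (k + 1) * (2 * n) := by
  rw [norm_smul, norm_pow, norm_inv, Real.norm_natCast]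
  exact mul_le_mul_of_nonneg_left (norm_digitVec_le w) (by positivity)

lemma summable_digit_bound {n : ℕ} (hn : 2 ≤ n) :
    Summable fun k : ℕ => ((n : ℝ)⁻¹) ^ (k + 1) * (2 * n) := by
  apply Summable.mul_right
  have h2 : (2 : ℝ) ≤ n := by exact_mod_cast hn
  have h : ((n : ℝ)⁻¹) < 1 := inv_lt_one_of_one_lt₀ (by linarith)
  exact (summable_nat_add_iff 1).2 (summable_geometric_of_lt_one (by positivity) h)

lemma summable_digits {n : ℕ} (hn : 2 ≤ n) (w : ℕ → Fin n × Fin n) :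
    Summable fun k : ℕ => ((n : ℝ)⁻¹) ^ (k + 1) • digitVec (w k) :=
  (summable_digit_bound hn).of_norm_bounded fun k => norm_digit_term_le (w k) k

lemma isFractalSquare_fractalSquare {n : ℕ} (hn : 2 ≤ n) (D : Finset (Fin n × Fin n))
    (hD : D.Nonempty) : IsFractalSquare D (fractalSquare D) := by
  obtain ⟨d₀, hd₀⟩ := hD
  refine ⟨⟨_, fun _ => d₀, fun _ => hd₀, (summable_digits hn _).hasSum⟩, ?_, ?_⟩
  · have hr : fractalSquare D = Set.range (fun w : ℕ → D =>
        ∑' k : ℕ, ((n : ℝ)⁻¹) ^ (k + 1) • digitVec (w k : Fin n × Fin n)) := by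
      ext x
      constructor
      · rintro ⟨w, hw, hx⟩
        exact ⟨fun k => ⟨w k, hw k⟩, hx.tsum_eq⟩
      · rintro ⟨w, rfl⟩
        exact ⟨fun k => w k, fun k => (w k).2, (summable_digits hn _).hasSum⟩
    rw [hr]
    apply isCompact_range
    refine continuous_tsum (fun k => ?_) (summable_digit_bound hn)
      (fun k w => norm_digit_term_le _ k)
    have : Continuous fun d : D => ((n : ℝ)⁻¹) ^ (k + 1) • digitVec (d : Fin n × Fin n) :=
      continuous_of_discreteTopology
    exact this.comp (continuous_apply k)
  · ext x
    simp only [Set.mem_iUnion, Set.mem_image, exists_prop]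
    constructor
    · rintro ⟨w, hw, hx⟩
      refine ⟨w 0, hw 0, ∑' k : ℕ, ((n : ℝ)⁻¹) ^ (k + 1) • digitVec (w (k + 1)),
        ⟨fun k => w (k + 1), fun k => hw _, (summable_digits hn _).hasSum⟩, ?_⟩
      rw [← hx.tsum_eq, (summable_digits hn w).tsum_eq_zero_add, digitMap, smul_add, add_comm,
        ← (summable_digits hn (fun k => w (k + 1))).tsum_const_smul]
      simp [smul_smul, pow_succ']
    · rintro ⟨d, hd, y, ⟨w, hw, hy⟩, rfl⟩
      refine ⟨fun k => Nat.casesOn k d w, fun k => by cases k <;> simp [hd, hw], ?_⟩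
      rw [← hasSum_nat_add_iff' 1]
      have := hy.const_smul ((n : ℝ)⁻¹)
      convert this using 1
      · funext k
        simp [smul_smul, pow_succ']
      · simp [digitMap]

/-- For `n ≥ 2` and a nonempty digit set `D`, `fractalSquare D` is the unique nonempty compact
solution of the set equation `F = (F + D) / n`. -/
theorem isFractalSquare_iff {n : ℕ} (hn : 2 ≤ n) (D : Finset (Fin n × Fin n))
    (hD : D.Nonempty) (F : Set Plane) : IsFractalSquare D F ↔ F = fractalSquare D := by
  refine ⟨?_, fun h => h ▸ isFractalSquare_fractalSquare hn D hD⟩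
  rintro ⟨⟨y, hy⟩, hF, hE⟩
  have h2 : (2 : ℝ) ≤ n := by exact_mod_cast hn
  have h1 : ((n : ℝ)⁻¹) < 1 := inv_lt_one_of_one_lt₀ (by linarith)
  have h0 : (0 : ℝ) ≤ (n : ℝ)⁻¹ := by positivity
  have hmem : ∀ x, x ∈ F ↔ ∃ d ∈ D, ∃ z ∈ F, digitMap d z = x := fun x => by
    conv_lhs => rw [hE]
    simp
  have hzero : ∀ z : ℕ → Plane, (∀ k, z k ∈ F) →
      Filter.Tendsto (fun k => ((n : ℝ)⁻¹) ^ k • z k) Filter.atTop (nhds 0) := by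
    intro z hz
    obtain ⟨C, hC⟩ := hF.isBounded.exists_norm_le
    have hb : Filter.Tendsto (fun k : ℕ => ((n : ℝ)⁻¹) ^ k * C) Filter.atTop (nhds 0) := by
      simpa using (tendsto_pow_atTop_nhds_zero_of_lt_one h0 h1).mul_const C
    refine squeeze_zero_norm (fun k => ?_) hb
    rw [norm_smul, norm_pow, Real.norm_of_nonneg h0]
    exact mul_le_mul_of_nonneg_left (hC _ (hz k)) (by positivity)
  ext x
  constructor
  · intro hx
    haveI : Nonempty (Fin n × Fin n) := ⟨hD.choose⟩
    choose! g hg f hf hfg using fun x => (hmem x).1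
    let z : ℕ → Plane := fun k => f^[k] x
    have hz : ∀ k, z k ∈ F := fun k => by
      induction k with
      | zero => exact hx
      | succ k ih =>
        simp only [z, Function.iterate_succ_apply']
        exact hf _ ih
    refine ⟨fun k => g (z k), fun k => hg _ (hz k), ?_⟩
    have hsum : ∀ k, ∑ j ∈ Finset.range k, ((n : ℝ)⁻¹) ^ (j + 1) • digitVec (g (z j))
        = x - ((n : ℝ)⁻¹) ^ k • z k := fun k => by
      induction k with
      | zero => simp [z]
      | succ k ih =>
        have hs : z (k + 1) = f (z k) := by simp only [z, Function.iterate_succ_apply']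
        have he : z k = (n : ℝ)⁻¹ • (z (k + 1) + digitVec (g (z k))) := by
          rw [hs]
          exact (hfg _ (hz k)).symm
        have he' : ((n : ℝ)⁻¹) ^ k • z k = ((n : ℝ)⁻¹) ^ (k + 1) • z (k + 1)
            + ((n : ℝ)⁻¹) ^ (k + 1) • digitVec (g (z k)) := by
          conv_lhs => rw [he]
          rw [smul_smul, ← pow_succ, smul_add]
        rw [Finset.sum_range_succ, ih, he']
        abel
    refine (summable_digits hn _).hasSum_iff_tendsto_nat.2 ?_
    simp only [hsum]
    simpa using tendsto_const_nhds.sub (hzero z hz)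
  · rintro ⟨w, hw, hx⟩
    have hin : ∀ (k : ℕ) (v : ℕ → Fin n × Fin n), (∀ j, v j ∈ D) →
        (∑ j ∈ Finset.range k, ((n : ℝ)⁻¹) ^ (j + 1) • digitVec (v j))
          + ((n : ℝ)⁻¹) ^ k • y ∈ F := by
      intro k
      induction k with
      | zero => intro v _; simpa using hy
      | succ k ih =>
        intro v hv
        refine (hmem _).2 ⟨v 0, hv 0, _, ih (fun j => v (j + 1)) (fun j => hv _), ?_⟩
        rw [Finset.sum_range_succ', digitMap, smul_add, smul_add, Finset.smul_sum]
        simp only [smul_smul, ← pow_succ']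
        simp only [zero_add, pow_one]
        abel
    have ht := hx.tendsto_sum_nat.add (hzero (fun _ => y) (fun _ => hy))
    rw [add_zero] at ht
    exact hF.isClosed.mem_of_tendsto ht (Filter.Eventually.of_forall fun k => hin k w hw)

/-- The digit set of a label matrix `M`: with rows `i` and columns `j` numbered from `0`,
the entry `M i j = 1` means that `(j, n - 1 - i)` is a digit. -/
def labelDigits {n : ℕ} (M : Matrix (Fin n) (Fin n) ℕ) : Finset (Fin n × Fin n) :=
  Finset.univ.filter fun d => M (Fin.rev d.2) d.1 = 1

/-- The label matrix of the fractal square `F₆`. -/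
def labelM6 : Matrix (Fin 3) (Fin 3) ℕ :=
  !![0, 1, 0;
     0, 1, 0;
     1, 1, 1]

/-- The label matrix of the fractal square `F₉`. -/
def labelM9 : Matrix (Fin 3) (Fin 3) ℕ :=
  !![1, 0, 1;
     0, 1, 0;
     1, 0, 1]

/-- The fractal square `F₆`. -/
noncomputable def fractalF6 : Set Plane := fractalSquare (labelDigits labelM6)

/-- The fractal square `F₉`. -/
noncomputable def fractalF9 : Set Plane := fractalSquare (labelDigits labelM9)

/-- `a` is a `k`-branch point of `E`: a point of `E` such that `E \ {a}` has exactly `k`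
connected components. -/
def IsBranchPoint (k : ℕ) (E : Set Plane) (a : Plane) : Prop :=
  a ∈ E ∧ ENat.card (ConnectedComponents ↥(E \ {a})) = (k : ℕ∞)

/-- Lipschitz equivalence: there is a bi-Lipschitz bijection from `E` onto `F`. -/
def LipschitzEquivalent (E F : Set Plane) : Prop :=
  ∃ g : E ≃ F, ∃ C : ℝ, 0 < C ∧ ∀ x y : E,
    C⁻¹ * dist x y ≤ dist (g x) (g y) ∧ dist (g x) (g y) ≤ C * dist x y

/-!
Both fractal squares consist of five copies of themselves, scaled by `1 / 3`, which meet in single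
points and are arranged without cycles. They are connected because the copies are linked: at every
scale any two points are joined by a chain of small steps, and the sets are compact
(`IsFractalSquare.isPreconnected`).

The fixed point of one of the contractions `S` can be deleted explicitly: the set splits into the
unions of the iterated images under `S` of the pieces attached to the copy of `S`, which are
connected chains; if these chains lie in disjoint `S`-invariant open cones, they are the components
(`IsFractalSquare.card_connectedComponents_diff_fixPt`). This gives three components for `F₆` at the
midpoint of its base, and four for `F₉` at its centre.

For `F₉` the piece of digit `d` is a retract: `collapse d` inverts `S_d` on that piece and sends
every other piece to the corner (the port) through which it is attached. Hence `F₉ \ {S_d x}` and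
`F₉ \ {x}` have equally many components unless `S_d x` is a point where two pieces touch
(`card_connectedComponents_digitMap`), and such a touching point leaves at most two components. So
if `a` is a `3`-branch point of `F₉`, following its address yields `3`-branch points forever. Three
points separated by `a` follow along under the collapses and, as distances triple while a point
stays in the piece of `a`, all three eventually become corners of `F₉`
(`not_isBranchPoint_fractalF9`). But a point separating three corners must lie in the central piece,
so from then on the address is constant and the point is the centre, which has four branches
(`not_separated_corners`). Branch points are preserved by homeomorphisms, and bi-Lipschitz bijections
are homeomorphisms.
-/

open Topology

/-! ### Connectedness inside a set -/

/-- `u` and `v` lie in a common preconnected subset of `E`. -/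
def ConnIn {X : Type*} [TopologicalSpace X] (E : Set X) (u v : X) : Prop :=
  ∃ K ⊆ E, IsPreconnected K ∧ u ∈ K ∧ v ∈ K

namespace ConnIn

variable {X Y : Type*} [TopologicalSpace X] [TopologicalSpace Y] {E : Set X} {u v w : X}

lemma refl (hu : u ∈ E) : ConnIn E u u :=
  ⟨{u}, by simpa, isPreconnected_singleton, rfl, rfl⟩

lemma symm (h : ConnIn E u v) : ConnIn E v u := by
  obtain ⟨K, h1, h2, h3, h4⟩ := h
  exact ⟨K, h1, h2, h4, h3⟩

lemma trans (h : ConnIn E u v) (h' : ConnIn E v w) : ConnIn E u w := by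
  obtain ⟨K, h1, h2, h3, h4⟩ := h
  obtain ⟨K', h1', h2', h3', h4'⟩ := h'
  exact ⟨K ∪ K', Set.union_subset h1 h1', h2.union v h4 h3' h2', Or.inl h3, Or.inr h4'⟩

lemma map {E' : Set Y} {f : X → Y} (hf : ContinuousOn f E) (hE : Set.MapsTo f E E')
    (h : ConnIn E u v) : ConnIn E' (f u) (f v) := by
  obtain ⟨K, h1, h2, h3, h4⟩ := h
  exact ⟨f '' K, (hE.mono_left h1).image_subset, h2.image f (hf.mono h1),
    Set.mem_image_of_mem f h3, Set.mem_image_of_mem f h4⟩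

lemma mk_eq_mk_iff {u v : E} :
    (u : ConnectedComponents E) = v ↔ ConnIn E (u : X) v := by
  rw [ConnectedComponents.coe_eq_coe']
  constructor
  · intro h
    refine ⟨Subtype.val '' connectedComponent v, by simp, ?_, ⟨u, h, rfl⟩,
      ⟨v, mem_connectedComponent, rfl⟩⟩
    exact isPreconnected_connectedComponent.image _ continuous_subtype_val.continuousOn
  · rintro ⟨K, h1, h2, h3, h4⟩
    have : IsPreconnected (Subtype.val ⁻¹' K : Set E) :=
      (Topology.IsInducing.subtypeVal.isPreconnected_image).1 (by
        rwa [Subtype.image_preimage_coe, Set.inter_eq_right.2 h1])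
    exact this.subset_connectedComponent h4 h3

end ConnIn

/-- A set covered by pairwise disjoint open sets `U i`, each of which meets it in a nonempty
preconnected set, has one component for each index. -/
lemma card_connectedComponents_of_cover {X ι : Type*} [TopologicalSpace X] [Fintype ι]
    {E : Set X} (U : ι → Set X) (hU : ∀ i, IsOpen (U i)) (hd : Pairwise fun i j => Disjoint (U i) (U j))
    (hE : E ⊆ ⋃ i, U i) (hne : ∀ i, (E ∩ U i).Nonempty) (hc : ∀ i, IsPreconnected (E ∩ U i)) :
    ENat.card (ConnectedComponents E) = Fintype.card ι := by
  have hex : ∀ u : E, ∃ i, (u : X) ∈ U i := fun u => by simpa using hE u.2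
  choose g hg using hex
  have huniq : ∀ (u : E) i, (u : X) ∈ U i → g u = i := fun u i hi => by
    by_contra hne
    exact Set.disjoint_left.1 (hd hne) (hg u) hi
  let _ : TopologicalSpace ι := ⊥
  have : DiscreteTopology ι := ⟨rfl⟩
  have hgc : Continuous g := by
    refine continuous_discrete_rng.2 fun i => ?_
    have : g ⁻¹' {i} = Subtype.val ⁻¹' U i := by
      ext u
      exact ⟨fun h => by have := hg u; rwa [show g u = i from h] at this, fun h => huniq u i h⟩
    rw [this]
    exact (hU i).preimage continuous_subtype_val
  have hbij : Function.Bijective hgc.connectedComponentsLift := by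
    constructor
    · intro p q
      obtain ⟨u, rfl⟩ := ConnectedComponents.surjective_coe p
      obtain ⟨v, rfl⟩ := ConnectedComponents.surjective_coe q
      simp only [Continuous.connectedComponentsLift_apply_coe]
      intro h
      exact ConnIn.mk_eq_mk_iff.2 ⟨_, Set.inter_subset_left, hc (g u), ⟨u.2, hg u⟩,
        ⟨v.2, h ▸ hg v⟩⟩
    · intro i
      obtain ⟨x, hx, hi⟩ := hne i
      exact ⟨((⟨x, hx⟩ : E) : ConnectedComponents E), by
        simpa using huniq ⟨x, hx⟩ i hi⟩
  rw [ENat.card_congr (Equiv.ofBijective _ hbij), ENat.card_eq_coe_fintype_card]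

lemma exists_three_of_card_eq_three {α : Type*} (h : ENat.card α = 3) :
    ∃ u v w : α, u ≠ v ∧ u ≠ w ∧ v ≠ w := by
  have h' : Nat.card α = 3 := by simp [Nat.card, ENat.card] at *; simp [h]
  obtain ⟨e⟩ : Nonempty (α ≃ Fin 3) := ⟨Nat.equivFinOfCardPos (by omega) |>.trans (finCongr h')⟩
  exact ⟨e.symm 0, e.symm 1, e.symm 2, by simp, by simp, by simp⟩

/-- Three pairwise separated points witness that there are three components. -/
lemma exists_three_not_connIn {X : Type*} [TopologicalSpace X] {E : Set X}
    (h : ENat.card (ConnectedComponents E) = 3) :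
    ∃ u ∈ E, ∃ v ∈ E, ∃ w ∈ E, ¬ ConnIn E u v ∧ ¬ ConnIn E u w ∧ ¬ ConnIn E v w := by
  obtain ⟨p, q, s, h1, h2, h3⟩ := exists_three_of_card_eq_three h
  obtain ⟨u, rfl⟩ := ConnectedComponents.surjective_coe p
  obtain ⟨v, rfl⟩ := ConnectedComponents.surjective_coe q
  obtain ⟨w, rfl⟩ := ConnectedComponents.surjective_coe s
  rw [Ne, ConnIn.mk_eq_mk_iff] at h1 h2 h3
  exact ⟨u, u.2, v, v.2, w, w.2, h1, h2, h3⟩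

/-- A set covered by two preconnected subsets does not have three components. -/
lemma card_connectedComponents_ne_three {X : Type*} [TopologicalSpace X] {E A B : Set X}
    (hA : IsPreconnected A) (hB : IsPreconnected B) (hAE : A ⊆ E) (hBE : B ⊆ E) (hE : E ⊆ A ∪ B) :
    ENat.card (ConnectedComponents E) ≠ 3 := by
  intro h
  obtain ⟨u, hu, v, hv, w, hw, h1, h2, h3⟩ := exists_three_not_connIn h
  have ha : ∀ {x y}, x ∈ A → y ∈ A → ConnIn E x y := fun hx hy => ⟨A, hAE, hA, hx, hy⟩
  have hb : ∀ {x y}, x ∈ B → y ∈ B → ConnIn E x y := fun hx hy => ⟨B, hBE, hB, hx, hy⟩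
  rcases hE hu with hu | hu <;> rcases hE hv with hv | hv <;> rcases hE hw with hw | hw <;>
    first
      | exact h1 (ha hu hv) | exact h1 (hb hu hv) | exact h2 (ha hu hw) | exact h2 (hb hu hw)
      | exact h3 (ha hv hw) | exact h3 (hb hv hw)

/-! ### Fractal squares with `n = 3` -/

/-- The fixed point of the contraction `digitMap d`, for `n = 3`. -/
noncomputable def fixPt (d : Fin 3 × Fin 3) : Plane := (2 : ℝ)⁻¹ • digitVec d

@[simp] lemma fixPt_zero (d : Fin 3 × Fin 3) : fixPt d 0 = ((d.1 : ℕ) : ℝ) / 2 := by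
  simp [fixPt, digitVec]; ring

@[simp] lemma fixPt_one (d : Fin 3 × Fin 3) : fixPt d 1 = ((d.2 : ℕ) : ℝ) / 2 := by
  simp [fixPt, digitVec]; ring

@[simp] lemma digitMap_zero (d : Fin 3 × Fin 3) (x : Plane) :
    digitMap d x 0 = (x 0 + ((d.1 : ℕ) : ℝ)) / 3 := by
  simp [digitMap, digitVec]; ring

@[simp] lemma digitMap_one (d : Fin 3 × Fin 3) (x : Plane) :
    digitMap d x 1 = (x 1 + ((d.2 : ℕ) : ℝ)) / 3 := by
  simp [digitMap, digitVec]; ring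

lemma Plane.ext {x y : Plane} (h0 : x 0 = y 0) (h1 : x 1 = y 1) : x = y := by
  ext i
  fin_cases i <;> assumption

@[simp] lemma digitMap_fixPt (d : Fin 3 × Fin 3) : digitMap d (fixPt d) = fixPt d := by
  apply Plane.ext <;> simp <;> ring

lemma dist_digitMap (d : Fin 3 × Fin 3) (x y : Plane) :
    dist (digitMap d x) (digitMap d y) = dist x y / 3 := by
  simp [digitMap, dist_smul₀]; ring

@[fun_prop] lemma continuous_digitMap (d : Fin 3 × Fin 3) : Continuous (digitMap d) := by
  unfold digitMap; fun_prop

lemma digitMap_injective (d : Fin 3 × Fin 3) : Function.Injective (digitMap d) := fun x y h => by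
  have := dist_digitMap d x y
  rw [h, dist_self] at this
  exact dist_le_zero.1 (by linarith)

namespace IsFractalSquare

variable {D : Finset (Fin 3 × Fin 3)} {F : Set Plane}

lemma mapsTo (hF : IsFractalSquare D F) {d : Fin 3 × Fin 3} (hd : d ∈ D) {x : Plane}
    (hx : x ∈ F) : digitMap d x ∈ F := by
  rw [hF.2.2]
  exact Set.mem_biUnion hd ⟨x, hx, rfl⟩

lemma exists_eq (hF : IsFractalSquare D F) {x : Plane} (hx : x ∈ F) :
    ∃ d ∈ D, ∃ y ∈ F, digitMap d y = x := by
  have h := hF.2.2 ▸ hx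
  simpa using h

/-- A linear functional is bounded on `F` by half of its bound on the digits: at a point
`(y + d) / 3` of `F` where it is maximal, compare its value with that at `y`. -/
lemma linear_le (hF : IsFractalSquare D F) (p q c : ℝ)
    (h : ∀ d ∈ D, p * ((d.1 : ℕ) : ℝ) + q * ((d.2 : ℕ) : ℝ) ≤ 2 * c) {x : Plane} (hx : x ∈ F) :
    p * x 0 + q * x 1 ≤ c := by
  obtain ⟨m, hm, hmax⟩ := hF.2.1.exists_isMaxOn hF.1
    (f := fun x : Plane => p * x 0 + q * x 1) (by fun_prop)
  refine (hmax hx).trans ?_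
  obtain ⟨d, hd, y, hy, rfl⟩ := hF.exists_eq hm
  have h1 : p * y 0 + q * y 1 ≤ _ := hmax hy
  have h2 := h d hd
  simp only [digitMap_zero, digitMap_one] at h1 ⊢
  linarith

lemma nonneg_zero (hF : IsFractalSquare D F) {x : Plane} (hx : x ∈ F) : 0 ≤ x 0 := by
  have := hF.linear_le (-1) 0 0 (fun d _ => by simp) hx
  linarith

lemma nonneg_one (hF : IsFractalSquare D F) {x : Plane} (hx : x ∈ F) : 0 ≤ x 1 := by
  have := hF.linear_le 0 (-1) 0 (fun d _ => by simp) hx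
  linarith

lemma natCast_fin_three_le (i : Fin 3) : ((i : ℕ) : ℝ) ≤ 2 := by
  exact_mod_cast (by omega : (i : ℕ) ≤ 2)

lemma le_one_zero (hF : IsFractalSquare D F) {x : Plane} (hx : x ∈ F) : x 0 ≤ 1 := by
  have := hF.linear_le 1 0 1 (fun d _ => by simpa using natCast_fin_three_le d.1) hx
  linarith

lemma le_one_one (hF : IsFractalSquare D F) {x : Plane} (hx : x ∈ F) : x 1 ≤ 1 := by
  have := hF.linear_le 0 1 1 (fun d _ => by simpa using natCast_fin_three_le d.2) hx
  linarith

lemma dist_lt_two (hF : IsFractalSquare D F) {x y : Plane} (hx : x ∈ F) (hy : y ∈ F) :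
    dist x y < 2 := by
  have h1 := hF.nonneg_zero hx
  have h2 := hF.nonneg_one hx
  have h3 := hF.nonneg_zero hy
  have h4 := hF.nonneg_one hy
  have h5 := hF.le_one_zero hx
  have h6 := hF.le_one_one hx
  have h7 := hF.le_one_zero hy
  have h8 := hF.le_one_one hy
  rw [EuclideanSpace.dist_eq, Real.sqrt_lt' (by norm_num), Fin.sum_univ_two, Real.dist_eq,
    Real.dist_eq, sq_abs, sq_abs]
  nlinarith

lemma fixPt_mem (hF : IsFractalSquare D F) {d : Fin 3 × Fin 3} (hd : d ∈ D) : fixPt d ∈ F := by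
  rw [(isFractalSquare_iff (by norm_num) D ⟨d, hd⟩ F).1 hF]
  refine ⟨fun _ => d, fun _ => hd, ?_⟩
  have h : HasSum (fun k : ℕ => ((3 : ℕ) : ℝ)⁻¹ ^ (k + 1)) (2 : ℝ)⁻¹ := by
    have := (hasSum_geometric_of_lt_one (r := ((3 : ℕ) : ℝ)⁻¹) (by positivity)
      (by norm_num)).mul_left ((3 : ℕ) : ℝ)⁻¹
    simp only [← pow_succ'] at this
    rwa [show ((3 : ℕ) : ℝ)⁻¹ * (1 - ((3 : ℕ) : ℝ)⁻¹)⁻¹ = (2 : ℝ)⁻¹ by norm_num] at this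
  exact h.smul_const (digitVec d)

/-- A fractal square whose pieces `digitMap d '' F` are linked is preconnected, since
it is compact and `2 / 3 ^ k`-chain connected for every `k`. -/
lemma isPreconnected (hF : IsFractalSquare D F)
    (hD : ∀ d ∈ D, ∀ e ∈ D, Relation.ReflTransGen
      (fun d e => (digitMap d '' F ∩ digitMap e '' F).Nonempty ∧ d ∈ D ∧ e ∈ D) d e) :
    IsPreconnected F := by
  let R : ℝ → Plane → Plane → Prop := fun δ =>
    Relation.ReflTransGen fun x y => x ∈ F ∧ y ∈ F ∧ dist x y ≤ δ
  have hscale : ∀ {δ : ℝ} {d x y}, d ∈ D → R δ x y → R (δ / 3) (digitMap d x) (digitMap d y) := by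
    intro δ d x y hd h
    refine Relation.ReflTransGen.lift (digitMap d) ?_ _ _ h
    intro x y hxy
    refine ⟨hF.mapsTo hd hxy.1, hF.mapsTo hd hxy.2.1, ?_⟩
    rw [dist_digitMap]
    linarith [hxy.2.2]
  have hchain : ∀ k : ℕ, ∀ x ∈ F, ∀ y ∈ F, R (2 / 3 ^ k) x y := by
    intro k
    induction k with
    | zero =>
      intro x hx y hy
      exact Relation.ReflTransGen.single ⟨hx, hy, by simpa using (hF.dist_lt_two hx hy).le⟩
    | succ k ih =>
      intro x hx y hy
      rw [pow_succ, ← div_div]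
      obtain ⟨d, hd, x', hx', rfl⟩ := hF.exists_eq hx
      obtain ⟨e, he, y', hy', rfl⟩ := hF.exists_eq hy
      clear hy
      induction hD d hd e he generalizing y' with
      | refl => exact hscale hd (ih _ hx' _ hy')
      | tail _ h ih' =>
        obtain ⟨⟨_, ⟨z, hz, rfl⟩, ⟨z', hz', hzz⟩⟩, hb, hc⟩ := h
        refine (ih' hb z hz).trans ?_
        rw [← hzz]
        exact hscale hc (ih _ hz' _ hy')
  rw [isPreconnected_closed_iff]
  intro A B hA hB hAB ⟨x, hxF, hxA⟩ ⟨y, hyF, hyB⟩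
  by_contra hne
  have hdisj : Disjoint (F ∩ A) (F ∩ B) := by
    rw [Set.disjoint_left]
    rintro z ⟨h1, h2⟩ ⟨_, h3⟩
    exact hne ⟨z, h1, h2, h3⟩
  obtain ⟨δ, hδ, hδd⟩ := hdisj.exists_thickenings (hF.2.1.inter_right hA)
    (hF.2.1.isClosed.inter hB)
  obtain ⟨k, hk⟩ : ∃ k : ℕ, 2 / 3 ^ k < δ := by
    have ht : Filter.Tendsto (fun k : ℕ => (2 : ℝ) / 3 ^ k) Filter.atTop (𝓝 0) :=
      tendsto_const_nhds.div_atTop (tendsto_pow_atTop_atTop_of_one_lt (by norm_num))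
    exact (ht.eventually_lt_const hδ).exists
  -- a chain with steps shorter than the gap never leaves `A`
  have hstay : ∀ z, R (2 / 3 ^ k) x z → z ∈ A := by
    intro z hz
    induction hz with
    | refl => exact hxA
    | @tail b c _ h ih =>
      obtain ⟨hb, hc, hbc⟩ := h
      refine (hAB hc).resolve_right fun hcB => ?_
      have hcA : c ∈ Metric.thickening δ (F ∩ A) :=
        Metric.mem_thickening_iff.2 ⟨b, ⟨hb, ih⟩, by rw [dist_comm]; linarith⟩
      exact Set.disjoint_left.1 hδd hcA (Metric.self_subset_thickening hδ _ ⟨hc, hcB⟩)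
  exact hne ⟨y, hyF, hstay y (hchain k x hxF y hyF), hyB⟩

/-! ### Deleting a fixed point -/

/-- If `F` is covered by the piece `digitMap d '' F` and further sets `R i`, then `F` without the
fixed point of `digitMap d` is covered by the images of the `R i` under the iterates. -/
lemma exists_mem_iterate (hF : IsFractalSquare D F) {d : Fin 3 × Fin 3} {ι : Type*}
    {R : ι → Set Plane} (hcov : ∀ x ∈ F, x ∈ digitMap d '' F ∨ ∃ i, x ∈ R i) (hd : d ∈ D)
    {x : Plane} (hx : x ∈ F) (hne : x ≠ fixPt d) : ∃ i, ∃ k : ℕ, x ∈ (digitMap d)^[k] '' R i := by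
  by_contra! hcon
  have hdist : ∀ (k : ℕ) (y z : Plane),
      dist ((digitMap d)^[k] y) ((digitMap d)^[k] z) = dist y z / 3 ^ k := by
    intro k y z
    induction k with
    | zero => simp
    | succ k ih =>
      rw [Function.iterate_succ_apply', Function.iterate_succ_apply', dist_digitMap, ih, pow_succ,
        div_div]
  have hall : ∀ k : ℕ, ∃ y ∈ F, (digitMap d)^[k] y = x := by
    intro k
    induction k with
    | zero => exact ⟨x, hx, rfl⟩
    | succ k ih =>
      obtain ⟨y, hy, hyx⟩ := ih
      rcases hcov y hy with ⟨z, hz, rfl⟩ | ⟨i, hi⟩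
      · exact ⟨z, hz, hyx⟩
      · exact absurd ⟨y, hi, hyx⟩ (hcon i k)
  have hfix : ∀ k : ℕ, (digitMap d)^[k] (fixPt d) = fixPt d := fun k =>
    Function.iterate_fixed (digitMap_fixPt d) k
  have hle : ∀ k : ℕ, dist x (fixPt d) ≤ 2 / 3 ^ k := by
    intro k
    obtain ⟨y, hy, hyx⟩ := hall k
    rw [← hfix k, ← hyx, hdist]
    have := hF.dist_lt_two hy (hF.fixPt_mem hd)
    gcongr
  have ht : Filter.Tendsto (fun k : ℕ => (2 : ℝ) / 3 ^ k) Filter.atTop (𝓝 0) :=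
    tendsto_const_nhds.div_atTop (tendsto_pow_atTop_atTop_of_one_lt (by norm_num))
  exact hne (dist_le_zero.1 (ge_of_tendsto' ht hle))

lemma isPreconnected_iUnion_iterate {d : Fin 3 × Fin 3} {R : Set Plane} (hR : IsPreconnected R)
    (hmeet : (R ∩ digitMap d '' R).Nonempty) :
    IsPreconnected (⋃ k : ℕ, (digitMap d)^[k] '' R) := by
  refine IsPreconnected.iUnion_of_chain
    (fun k => hR.image _ ((continuous_digitMap d).iterate k).continuousOn) fun k => ?_
  obtain ⟨_, hx, ⟨y, hy, rfl⟩⟩ := hmeet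
  exact ⟨(digitMap d)^[k] (digitMap d y), ⟨_, hx, rfl⟩, ⟨y, hy,
    Function.iterate_succ_apply (digitMap d) k y⟩⟩

lemma iUnion_iterate_subset (hF : IsFractalSquare D F) {d : Fin 3 × Fin 3} (hd : d ∈ D)
    {R : Set Plane} (hR : R ⊆ F \ {fixPt d}) :
    (⋃ k : ℕ, (digitMap d)^[k] '' R) ⊆ F \ {fixPt d} := by
  rintro _ hx
  obtain ⟨k, y, hy, rfl⟩ := Set.mem_iUnion.1 hx
  refine ⟨?_, fun h => (hR hy).2 ?_⟩
  · have : ∀ z ∈ F, digitMap d z ∈ F := fun z hz => hF.mapsTo hd hz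
    exact (Set.MapsTo.iterate this k) (hR hy).1
  · rw [Set.mem_singleton_iff, ← Function.iterate_fixed (digitMap_fixPt d) k] at h
    exact (digitMap_injective d).iterate k h

/-- Deleting the fixed point of `digitMap d` from `F` leaves one component for each index `i`, if
`F` is covered by `digitMap d '' F` and sets `R i` that are chained to their own images under
`digitMap d` and lie in disjoint open sets invariant under `digitMap d`. -/
lemma card_connectedComponents_diff_fixPt (hF : IsFractalSquare D F) {d : Fin 3 × Fin 3}
    (hd : d ∈ D) {ι : Type*} [Fintype ι] (R U : ι → Set Plane)
    (hcov : ∀ x ∈ F, x ∈ digitMap d '' F ∨ ∃ i, x ∈ R i)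
    (hRF : ∀ i, R i ⊆ F) (hR : ∀ i, IsPreconnected (R i))
    (hmeet : ∀ i, (R i ∩ digitMap d '' R i).Nonempty)
    (hU : ∀ i, IsOpen (U i))
    (hdisj : Pairwise fun i j => Disjoint (U i) (U j))
    (hUmap : ∀ i, ∀ x ∈ U i, digitMap d x ∈ U i) (hUfix : ∀ i, fixPt d ∉ U i)
    (hRU : ∀ i, R i ⊆ U i) :
    ENat.card (ConnectedComponents ↥(F \ {fixPt d})) = Fintype.card ι := by
  have hRE : ∀ i, R i ⊆ F \ {fixPt d} := fun i x hx =>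
    ⟨hRF i hx, fun h => hUfix i (h ▸ hRU i hx)⟩
  have hAU : ∀ i, (⋃ k : ℕ, (digitMap d)^[k] '' R i) ⊆ U i := by
    intro i x hx
    obtain ⟨k, y, hy, rfl⟩ := Set.mem_iUnion.1 hx
    exact Set.MapsTo.iterate (hUmap i) k (hRU i hy)
  have hA : ∀ i, (F \ {fixPt d}) ∩ U i = ⋃ k : ℕ, (digitMap d)^[k] '' R i := by
    intro i
    refine Set.Subset.antisymm ?_ (Set.subset_inter (hF.iUnion_iterate_subset hd (hRE i)) (hAU i))
    rintro x ⟨⟨hx, hne⟩, hxU⟩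
    obtain ⟨j, k, hk⟩ := hF.exists_mem_iterate hcov hd hx hne
    have hxj : x ∈ ⋃ k : ℕ, (digitMap d)^[k] '' R j := Set.mem_iUnion.2 ⟨k, hk⟩
    obtain rfl : i = j := by
      by_contra hij
      exact Set.disjoint_left.1 (hdisj hij) hxU (hAU j hxj)
    exact hxj
  refine card_connectedComponents_of_cover U hU hdisj ?_ (fun i => ?_) fun i => ?_
  · rintro x ⟨hx, hne⟩
    obtain ⟨j, k, hk⟩ := hF.exists_mem_iterate hcov hd hx hne
    exact Set.mem_iUnion.2 ⟨j, hAU j (Set.mem_iUnion.2 ⟨k, hk⟩)⟩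
  · obtain ⟨x, hx, -⟩ := hmeet i
    exact ⟨x, hRE i hx, hRU i hx⟩
  · rw [hA]
    exact isPreconnected_iUnion_iterate (hR i) (hmeet i)

end IsFractalSquare

/-! ### Linked pieces -/

/-- Attaching connected sets to a connected set which meets each of them. -/
lemma isPreconnected_union_biUnion {X ι : Type*} [TopologicalSpace X] {H : Set X} {T : ι → Set X}
    {I : Set ι} (hH : IsPreconnected H) (hT : ∀ i ∈ I, IsPreconnected (T i))
    (hHT : ∀ i ∈ I, (H ∩ T i).Nonempty) : IsPreconnected (H ∪ ⋃ i ∈ I, T i) := by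
  rcases H.eq_empty_or_nonempty with rfl | ⟨x, hx⟩
  · have : I = ∅ := Set.eq_empty_of_forall_notMem fun i hi => by simpa using hHT i hi
    simpa [this] using isPreconnected_empty
  refine isPreconnected_of_forall x fun y hy => ?_
  rcases hy with hy | hy
  · exact ⟨H, Set.subset_union_left, hx, hy, hH⟩
  · simp only [Set.mem_iUnion] at hy
    obtain ⟨i, hi, hy⟩ := hy
    exact ⟨H ∪ T i, Set.union_subset_union_right _ (Set.subset_biUnion_of_mem hi), Or.inl hx,
      Or.inr hy, hH.union' (hHT i hi) (hT i hi)⟩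

lemma isOpen_lt_and_lt {X : Type*} [TopologicalSpace X] {f g h k : X → ℝ} (hf : Continuous f)
    (hg : Continuous g) (hh : Continuous h) (hk : Continuous k) :
    IsOpen {x | f x < g x ∧ h x < k x} :=
  (isOpen_lt hf hg).inter (isOpen_lt hh hk)

namespace IsFractalSquare

variable {D : Finset (Fin 3 × Fin 3)} {F : Set Plane}

lemma inter_nonempty (hF : IsFractalSquare D F) {d e p q : Fin 3 × Fin 3} (hp : p ∈ D) (hq : q ∈ D)
    (h : digitMap d (fixPt p) = digitMap e (fixPt q)) :
    (digitMap d '' F ∩ digitMap e '' F).Nonempty :=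
  ⟨_, ⟨_, hF.fixPt_mem hp, rfl⟩, ⟨_, hF.fixPt_mem hq, h.symm⟩⟩

/-- It suffices for connectedness that each piece is linked to one fixed piece. -/
lemma isConnected_of_hub (hF : IsFractalSquare D F) (c : Fin 3 × Fin 3)
    (hD : ∀ d ∈ D, Relation.ReflTransGen
      (fun d e => (digitMap d '' F ∩ digitMap e '' F).Nonempty ∧ d ∈ D ∧ e ∈ D) c d) :
    IsConnected F := by
  refine ⟨hF.1, hF.isPreconnected fun d hd e he => ?_⟩
  have hsymm : Std.Symm fun d e =>
      (digitMap d '' F ∩ digitMap e '' F).Nonempty ∧ d ∈ D ∧ e ∈ D :=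
    ⟨fun _ _ ⟨h1, h2, h3⟩ => ⟨by rwa [Set.inter_comm], h3, h2⟩⟩
  exact (Relation.ReflTransGen.stdSymm.symm _ _ (hD d hd)).trans (hD e he)

lemma isPreconnected_image (hF : IsPreconnected F) (d : Fin 3 × Fin 3) :
    IsPreconnected (digitMap d '' F) :=
  hF.image _ (continuous_digitMap d).continuousOn

end IsFractalSquare

/-! ### The fractal square `F₆` -/

lemma mem_labelDigits_labelM6 {d : Fin 3 × Fin 3} : d ∈ labelDigits labelM6 ↔
    d = (0, 0) ∨ d = (1, 0) ∨ d = (2, 0) ∨ d = (1, 1) ∨ d = (1, 2) := by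
  revert d; decide

lemma isFractalSquare_fractalF6 : IsFractalSquare (labelDigits labelM6) fractalF6 :=
  isFractalSquare_fractalSquare (by norm_num) _ ⟨(0, 0), by decide⟩

lemma isConnected_fractalF6 : IsConnected fractalF6 := by
  have hF := isFractalSquare_fractalF6
  have h0 : (digitMap (1, 0) '' fractalF6 ∩ digitMap (0, 0) '' fractalF6).Nonempty :=
    hF.inter_nonempty (p := (0, 0)) (q := (2, 0)) (by decide) (by decide)
      (by apply Plane.ext <;> simp)
  have h2 : (digitMap (1, 0) '' fractalF6 ∩ digitMap (2, 0) '' fractalF6).Nonempty :=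
    hF.inter_nonempty (p := (2, 0)) (q := (0, 0)) (by decide) (by decide)
      (by apply Plane.ext <;> simp; norm_num)
  have h11 : (digitMap (1, 0) '' fractalF6 ∩ digitMap (1, 1) '' fractalF6).Nonempty :=
    hF.inter_nonempty (p := (1, 2)) (q := (1, 0)) (by decide) (by decide)
      (by apply Plane.ext <;> simp)
  have h12 : (digitMap (1, 1) '' fractalF6 ∩ digitMap (1, 2) '' fractalF6).Nonempty :=
    hF.inter_nonempty (p := (1, 2)) (q := (1, 0)) (by decide) (by decide)
      (by apply Plane.ext <;> simp; norm_num)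
  refine hF.isConnected_of_hub (1, 0) fun d hd => ?_
  rcases mem_labelDigits_labelM6.1 hd with rfl | rfl | rfl | rfl | rfl
  · exact .single ⟨h0, by decide, by decide⟩
  · exact .refl
  · exact .single ⟨h2, by decide, by decide⟩
  · exact .single ⟨h11, by decide, by decide⟩
  · exact .tail (.single ⟨h11, by decide, by decide⟩) ⟨h12, by decide, by decide⟩

/-- The midpoint of the base of `F₆` is a branch point of order three: the left, the right and
the upper branch at that point lie in three disjoint cones. -/
lemma isBranchPoint_fractalF6 : IsBranchPoint 3 fractalF6 (fixPt (1, 0)) := by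
  have hF := isFractalSquare_fractalF6
  have hc := isConnected_fractalF6.isPreconnected
  refine ⟨hF.fixPt_mem (by decide), ?_⟩
  let S : Fin 3 × Fin 3 → Set Plane := fun d => digitMap d '' fractalF6
  let R : Fin 3 → Set Plane := ![S (0, 0), S (2, 0), S (1, 1) ∪ S (1, 2)]
  -- `F₆` lies below the lines `x 1 = 2 * x 0` and `x 1 = 2 * (1 - x 0)`, so that a cone whose
  -- sides have a slope of modulus `5 / 3` separates the first two branches from the third
  let U : Fin 3 → Set Plane := ![{x | x 1 < 5 / 3 * (1 / 2 - x 0) ∧ x 0 < 1 / 2},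
    {x | x 1 < 5 / 3 * (x 0 - 1 / 2) ∧ 1 / 2 < x 0},
    {x | 5 / 3 * (1 / 2 - x 0) < x 1 ∧ 5 / 3 * (x 0 - 1 / 2) < x 1}]
  have hl : ∀ x ∈ fractalF6, x 1 ≤ 2 * x 0 := fun x hx => by
    have := hF.linear_le (-2) 1 0 (fun d hd => by
      rcases mem_labelDigits_labelM6.1 hd with rfl | rfl | rfl | rfl | rfl <;> norm_num) hx
    linarith
  have hr : ∀ x ∈ fractalF6, x 1 ≤ 2 * (1 - x 0) := fun x hx => by
    have := hF.linear_le 2 1 2 (fun d hd => by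
      rcases mem_labelDigits_labelM6.1 hd with rfl | rfl | rfl | rfl | rfl <;> norm_num) hx
    linarith
  have key := hF.card_connectedComponents_diff_fixPt (d := (1, 0)) (by decide) R U
    ?_ ?_ ?_ ?_ ?_ ?_ ?_ ?_ ?_
  · simpa using key
  · intro x hx
    obtain ⟨d, hd, y, hy, rfl⟩ := hF.exists_eq hx
    rcases mem_labelDigits_labelM6.1 hd with rfl | rfl | rfl | rfl | rfl
    · exact Or.inr ⟨0, y, hy, rfl⟩
    · exact Or.inl ⟨y, hy, rfl⟩
    · exact Or.inr ⟨1, y, hy, rfl⟩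
    · exact Or.inr ⟨2, Or.inl ⟨y, hy, rfl⟩⟩
    · exact Or.inr ⟨2, Or.inr ⟨y, hy, rfl⟩⟩
  · have h : ∀ d ∈ labelDigits labelM6, digitMap d '' fractalF6 ⊆ fractalF6 := fun d hd =>
      Set.image_subset_iff.2 fun x hx => hF.mapsTo hd hx
    intro i
    fin_cases i
    · exact h _ (by decide)
    · exact h _ (by decide)
    · exact Set.union_subset (h _ (by decide)) (h _ (by decide))
  · intro i
    fin_cases i
    · exact IsFractalSquare.isPreconnected_image hc _
    · exact IsFractalSquare.isPreconnected_image hc _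
    · refine (IsFractalSquare.isPreconnected_image hc _).union' ?_
        (IsFractalSquare.isPreconnected_image hc _)
      exact hF.inter_nonempty (p := (1, 2)) (q := (1, 0)) (by decide) (by decide)
        (by apply Plane.ext <;> simp; norm_num)
  · have h : ∀ d ∈ labelDigits labelM6, fixPt d ∈ digitMap d '' fractalF6 := fun d hd =>
      ⟨_, hF.fixPt_mem hd, digitMap_fixPt d⟩
    have h' : ∀ {p : Fin 3 × Fin 3}, p ∈ labelDigits labelM6 → ∀ d : Fin 3 × Fin 3,
        digitMap d (fixPt p) ∈ digitMap d '' fractalF6 :=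
      fun hp d => ⟨_, hF.fixPt_mem hp, rfl⟩
    intro i
    fin_cases i
    · refine ⟨digitMap (0, 0) (fixPt (2, 0)), h' (by decide) _, fixPt (0, 0), h _ (by decide), ?_⟩
      apply Plane.ext <;> simp
    · refine ⟨digitMap (2, 0) (fixPt (0, 0)), h' (by decide) _, fixPt (2, 0), h _ (by decide), ?_⟩
      apply Plane.ext <;> simp
      norm_num
    · refine ⟨digitMap (1, 1) (fixPt (1, 0)), Or.inl (h' (by decide) _), fixPt (1, 2),
        Or.inr (h _ (by decide)), ?_⟩
      apply Plane.ext <;> simp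
  · intro i
    fin_cases i
    · exact isOpen_lt_and_lt (by fun_prop) (by fun_prop) (by fun_prop) (by fun_prop)
    · exact isOpen_lt_and_lt (by fun_prop) (by fun_prop) (by fun_prop) (by fun_prop)
    · exact isOpen_lt_and_lt (by fun_prop) (by fun_prop) (by fun_prop) (by fun_prop)
  · intro i j hij
    rw [Set.disjoint_left]
    fin_cases i <;> fin_cases j <;> first | exact absurd rfl hij | skip
    all_goals
      rintro x ⟨h1, h2⟩ ⟨h3, h4⟩
      linarith
  · intro i x hx
    fin_cases i <;> obtain ⟨h1, h2⟩ := hx <;> constructor <;> simp <;> linarith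
  · intro i hx
    fin_cases i <;> obtain ⟨h, -⟩ := hx <;> norm_num at h
  · intro i
    fin_cases i
    · rintro _ ⟨x, hx, rfl⟩
      have := hr x hx
      have := hF.nonneg_zero hx
      have := hF.le_one_zero hx
      constructor <;> simp <;> linarith
    · rintro _ ⟨x, hx, rfl⟩
      have := hl x hx
      have := hF.nonneg_zero hx
      have := hF.le_one_zero hx
      constructor <;> simp <;> linarith
    · rintro _ (⟨x, hx, rfl⟩ | ⟨x, hx, rfl⟩) <;>
      · have := hF.nonneg_zero hx
        have := hF.le_one_zero hx
        have := hF.nonneg_one hx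
        constructor <;> simp <;> linarith

/-! ### The fractal square `F₉` and its cells -/

/-- The four corner digits of `F₉`; its fifth digit is the centre `(1, 1)`. -/
def cornerDigits : Finset (Fin 3 × Fin 3) := {(0, 0), (2, 0), (0, 2), (2, 2)}

lemma mem_labelDigits_labelM9 {d : Fin 3 × Fin 3} :
    d ∈ labelDigits labelM9 ↔ d = (1, 1) ∨ d ∈ cornerDigits := by
  revert d; decide

lemma mem_cornerDigits {d : Fin 3 × Fin 3} :
    d ∈ cornerDigits ↔ d = (0, 0) ∨ d = (2, 0) ∨ d = (0, 2) ∨ d = (2, 2) := by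
  simp [cornerDigits]

lemma mem_of_mem_cornerDigits {d : Fin 3 × Fin 3} (hd : d ∈ cornerDigits) :
    d ∈ labelDigits labelM9 := mem_labelDigits_labelM9.2 (Or.inr hd)

lemma ne_center_of_mem_cornerDigits {d : Fin 3 × Fin 3} (hd : d ∈ cornerDigits) : d ≠ (1, 1) := by
  revert d; decide

/-- The digit opposite to `d`. -/
def oppDigit (d : Fin 3 × Fin 3) : Fin 3 × Fin 3 := (Fin.rev d.1, Fin.rev d.2)

lemma oppDigit_mem_cornerDigits {d : Fin 3 × Fin 3} (hd : d ∈ cornerDigits) :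
    oppDigit d ∈ cornerDigits := by
  revert d; decide

lemma oppDigit_ne {d : Fin 3 × Fin 3} (hd : d ∈ cornerDigits) : oppDigit d ≠ d := by
  revert d; decide

lemma fixPt_injective : Function.Injective fixPt := by
  intro d e h
  have h0 := congrArg (fun x : Plane => x 0) h
  have h1 := congrArg (fun x : Plane => x 1) h
  simp only [fixPt_zero, fixPt_one] at h0 h1
  have h0' : ((d.1 : ℕ) : ℝ) = ((e.1 : ℕ) : ℝ) := by linarith
  have h1' : ((d.2 : ℕ) : ℝ) = ((e.2 : ℕ) : ℝ) := by linarith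
  exact Prod.ext (Fin.ext (by exact_mod_cast h0')) (Fin.ext (by exact_mod_cast h1'))

/-- The corner piece at `d` and the central piece touch. -/
lemma digitMap_fixPt_oppDigit (d : Fin 3 × Fin 3) :
    digitMap d (fixPt (oppDigit d)) = digitMap ((1, 1) : Fin 3 × Fin 3) (fixPt d) := by
  obtain ⟨a, b⟩ := d
  apply Plane.ext
  · fin_cases a <;> (simp [oppDigit]; try norm_num)
  · fin_cases b <;> (simp [oppDigit]; try norm_num)

lemma isFractalSquare_fractalF9 : IsFractalSquare (labelDigits labelM9) fractalF9 :=
  isFractalSquare_fractalSquare (by norm_num) _ ⟨(0, 0), by decide⟩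

lemma fixPt_mem_fractalF9 {d : Fin 3 × Fin 3} (hd : d ∈ cornerDigits) : fixPt d ∈ fractalF9 :=
  isFractalSquare_fractalF9.fixPt_mem (mem_of_mem_cornerDigits hd)

lemma isConnected_fractalF9 : IsConnected fractalF9 := by
  have hF := isFractalSquare_fractalF9
  refine hF.isConnected_of_hub (1, 1) fun d hd => ?_
  rcases mem_labelDigits_labelM9.1 hd with rfl | hd'
  · exact .refl
  · exact .single ⟨hF.inter_nonempty hd (mem_of_mem_cornerDigits (oppDigit_mem_cornerDigits hd'))
      (digitMap_fixPt_oppDigit d).symm, by decide, hd⟩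

lemma isPreconnected_cell (d : Fin 3 × Fin 3) : IsPreconnected (digitMap d '' fractalF9) :=
  IsFractalSquare.isPreconnected_image isConnected_fractalF9.isPreconnected d

lemma cell_subset {d : Fin 3 × Fin 3} (hd : d ∈ labelDigits labelM9) :
    digitMap d '' fractalF9 ⊆ fractalF9 :=
  Set.image_subset_iff.2 fun _ hx => isFractalSquare_fractalF9.mapsTo hd hx

/-! ### Collapsing `F₉` onto one of its cells -/

/-- The corner of `F₉` at which, within the piece of digit `d` rescaled to `F₉`, the piece of digit
`e` is attached: all corners serve as ports of the central piece, while a corner piece has a single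
port, opposite to its own corner. Meant for distinct digits `d` and `e` of `F₉`. -/
noncomputable def port (d e : Fin 3 × Fin 3) : Plane :=
  if d = (1, 1) then fixPt e else fixPt (oppDigit d)

lemma port_center (e : Fin 3 × Fin 3) : port (1, 1) e = fixPt e := if_pos rfl

lemma port_corner {d : Fin 3 × Fin 3} (hd : d ∈ cornerDigits) (e : Fin 3 × Fin 3) :
    port d e = fixPt (oppDigit d) := if_neg (ne_center_of_mem_cornerDigits hd)

lemma exists_port_eq {d e : Fin 3 × Fin 3} (hd : d ∈ labelDigits labelM9)
    (he : e ∈ labelDigits labelM9) (hne : e ≠ d) : ∃ c ∈ cornerDigits, port d e = fixPt c := by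
  rcases mem_labelDigits_labelM9.1 hd with rfl | hd
  · exact ⟨e, (mem_labelDigits_labelM9.1 he).resolve_left hne, port_center e⟩
  · exact ⟨_, oppDigit_mem_cornerDigits hd, port_corner hd e⟩

/-- The reflection of a coordinate that moves the side `s / 2` of the unit interval to `0`. -/
def reflect (s : Fin 3) (t : ℝ) : ℝ := if s = 0 then t else 1 - t

/-- A map of the plane which inverts `digitMap d` on the piece of `F₉` of digit `d` and is constant
on each of the other pieces: for the centre it clamps `3 x - 1` to the unit square, and for a corner
it uses that `x 0 + x 1 ≤ 2 / 3` on the corner piece at the origin, while `2 / 3 ≤ x 0 + x 1` on the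
other pieces. -/
noncomputable def collapse (d : Fin 3 × Fin 3) (x : Plane) : Plane :=
  if d = (1, 1) then !₂[max 0 (min 1 (3 * x 0 - 1)), max 0 (min 1 (3 * x 1 - 1))]
  else
    !₂[reflect d.1 (min 1 (max (3 * reflect d.1 (x 0))
        (3 * reflect d.1 (x 0) + 3 * reflect d.2 (x 1) - 1))),
      reflect d.2 (min 1 (max (3 * reflect d.2 (x 1))
        (3 * reflect d.1 (x 0) + 3 * reflect d.2 (x 1) - 1)))]

lemma continuous_reflect (s : Fin 3) : Continuous (reflect s) := by
  unfold reflect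
  split_ifs <;> fun_prop

lemma continuous_collapse (d : Fin 3 × Fin 3) : Continuous (collapse d) := by
  have h1 : Continuous fun x : Plane => reflect d.1 (x 0) :=
    (continuous_reflect _).comp (by fun_prop)
  have h2 : Continuous fun x : Plane => reflect d.2 (x 1) :=
    (continuous_reflect _).comp (by fun_prop)
  unfold collapse
  split_ifs
  · refine (PiLp.continuous_toLp 2 _).comp (continuous_pi fun i => ?_)
    fin_cases i <;> simp <;> fun_prop
  · refine (PiLp.continuous_toLp 2 _).comp (continuous_pi fun i => ?_)
    fin_cases i
    · exact (continuous_reflect _).comp (by fun_prop)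
    · exact (continuous_reflect _).comp (by fun_prop)

lemma collapse_digitMap {d : Fin 3 × Fin 3} (hd : d ∈ labelDigits labelM9) {x : Plane}
    (hx : x ∈ fractalF9) : collapse d (digitMap d x) = x := by
  have h1 := isFractalSquare_fractalF9.nonneg_zero hx
  have h2 := isFractalSquare_fractalF9.nonneg_one hx
  have h3 := isFractalSquare_fractalF9.le_one_zero hx
  have h4 := isFractalSquare_fractalF9.le_one_one hx
  rw [mem_labelDigits_labelM9, mem_cornerDigits] at hd
  apply Plane.ext <;> rcases hd with rfl | rfl | rfl | rfl | rfl <;>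
    simp [collapse, reflect] <;> simp only [min_def, max_def] <;> split_ifs <;> linarith

lemma collapse_digitMap_of_ne {d e : Fin 3 × Fin 3} (hd : d ∈ labelDigits labelM9)
    (he : e ∈ labelDigits labelM9) (hne : e ≠ d) {x : Plane} (hx : x ∈ fractalF9) :
    collapse d (digitMap e x) = port d e := by
  have h1 := isFractalSquare_fractalF9.nonneg_zero hx
  have h2 := isFractalSquare_fractalF9.nonneg_one hx
  have h3 := isFractalSquare_fractalF9.le_one_zero hx
  have h4 := isFractalSquare_fractalF9.le_one_one hx
  rcases mem_labelDigits_labelM9.1 hd with rfl | hd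
  · have he := mem_cornerDigits.1 ((mem_labelDigits_labelM9.1 he).resolve_left hne)
    have hclamp : ∀ (i : Fin 3) (t : ℝ), i = 0 ∨ i = 2 → 0 ≤ t → t ≤ 1 →
        max 0 (min 1 (3 * ((t + ((i : ℕ) : ℝ)) / 3) - 1)) = ((i : ℕ) : ℝ) / 2 := by
      rintro i t (rfl | rfl) ht0 ht1
      · rw [max_eq_left ((min_le_right _ _).trans (by norm_num; linarith))]
        simp
      · rw [min_eq_left (by norm_num; linarith)]
        norm_num
    have he1 : e.1 = 0 ∨ e.1 = 2 := by rcases he with rfl | rfl | rfl | rfl <;> decide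
    have he2 : e.2 = 0 ∨ e.2 = 2 := by rcases he with rfl | rfl | rfl | rfl <;> decide
    apply Plane.ext
    · simpa [collapse, port_center] using hclamp e.1 (x 0) he1 h1 h3
    · simpa [collapse, port_center] using hclamp e.2 (x 1) he2 h2 h4
  · have hsum : 1 ≤ 3 * reflect d.1 (digitMap e x 0) + 3 * reflect d.2 (digitMap e x 1) - 1 := by
      rw [mem_labelDigits_labelM9, mem_cornerDigits] at he
      rw [mem_cornerDigits] at hd
      rcases hd with rfl | rfl | rfl | rfl <;> rcases he with rfl | rfl | rfl | rfl | rfl <;>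
        first | exact absurd rfl hne | (simp [reflect]; linarith)
    have hopp : ∀ i : Fin 3, i = 0 ∨ i = 2 → reflect i 1 = ((Fin.rev i : ℕ) : ℝ) / 2 := by
      rintro i (rfl | rfl) <;> simp [reflect]
    have hd' := mem_cornerDigits.1 hd
    have hd1 : d.1 = 0 ∨ d.1 = 2 := by rcases hd' with rfl | rfl | rfl | rfl <;> decide
    have hd2 : d.2 = 0 ∨ d.2 = 2 := by rcases hd' with rfl | rfl | rfl | rfl <;> decide
    rw [port_corner hd, collapse, if_neg (ne_center_of_mem_cornerDigits hd),
      min_eq_left (le_max_of_le_right hsum), min_eq_left (le_max_of_le_right hsum),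
      hopp _ hd1, hopp _ hd2]
    apply Plane.ext <;> simp [oppDigit]

/-- Distinct pieces of `F₉` meet at most in their port. -/
lemma eq_port_of_digitMap_eq {d e : Fin 3 × Fin 3} (hd : d ∈ labelDigits labelM9)
    (he : e ∈ labelDigits labelM9) (hne : e ≠ d) {x y : Plane} (hx : x ∈ fractalF9)
    (hy : y ∈ fractalF9) (h : digitMap d x = digitMap e y) : x = port d e := by
  rw [← collapse_digitMap hd hx, h, collapse_digitMap_of_ne hd he hne hy]

/-- The union of the pieces of `F₉` other than the one of digit `c`. -/
def otherCells (c : Fin 3 × Fin 3) : Set Plane :=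
  digitMap ((1, 1) : Fin 3 × Fin 3) '' fractalF9 ∪
    ⋃ e ∈ {e | e ∈ cornerDigits ∧ e ≠ c}, digitMap e '' fractalF9

lemma cell_subset_otherCells {c e : Fin 3 × Fin 3} (he : e ∈ labelDigits labelM9) (hne : e ≠ c) :
    digitMap e '' fractalF9 ⊆ otherCells c := by
  rcases mem_labelDigits_labelM9.1 he with rfl | he
  · exact Set.subset_union_left
  · exact Set.subset_union_of_subset_right
      (Set.subset_biUnion_of_mem (u := fun e => digitMap e '' fractalF9)
        (show e ∈ {e | e ∈ cornerDigits ∧ e ≠ c} from ⟨he, hne⟩)) _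

lemma exists_of_mem_otherCells {c : Fin 3 × Fin 3} (hc : c ∈ cornerDigits) {x : Plane}
    (hx : x ∈ otherCells c) : ∃ e ∈ labelDigits labelM9, e ≠ c ∧ ∃ y ∈ fractalF9,
      digitMap e y = x := by
  rcases hx with ⟨y, hy, rfl⟩ | hx
  · exact ⟨(1, 1), by decide, (ne_center_of_mem_cornerDigits hc).symm, y, hy, rfl⟩
  · simp only [Set.mem_iUnion] at hx
    obtain ⟨e, he, y, hy, rfl⟩ := hx
    exact ⟨e, mem_of_mem_cornerDigits he.1, he.2, y, hy, rfl⟩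

lemma isPreconnected_otherCells (c : Fin 3 × Fin 3) : IsPreconnected (otherCells c) := by
  refine isPreconnected_union_biUnion (isPreconnected_cell _) (fun e _ => isPreconnected_cell e)
    fun e he => ?_
  exact ⟨_, ⟨_, fixPt_mem_fractalF9 he.1, rfl⟩,
    ⟨_, fixPt_mem_fractalF9 (oppDigit_mem_cornerDigits he.1), digitMap_fixPt_oppDigit e⟩⟩

/-! ### Components of `F₉` without a point -/

/-- The centre of `F₉` is a branch point of order four. -/
lemma card_connectedComponents_center :
    ENat.card (ConnectedComponents ↥(fractalF9 \ {fixPt (1, 1)})) = 4 := by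
  have hF := isFractalSquare_fractalF9
  let R : cornerDigits → Set Plane := fun e => digitMap e.1 '' fractalF9
  let U : cornerDigits → Set Plane := fun e =>
    {x | 0 < (x 0 - 1 / 2) * (((e.1.1 : ℕ) : ℝ) - 1) ∧ 0 < (x 1 - 1 / 2) * (((e.1.2 : ℕ) : ℝ) - 1)}
  have key := hF.card_connectedComponents_diff_fixPt (d := (1, 1)) (by decide) R U
    ?_ ?_ ?_ ?_ ?_ ?_ ?_ ?_ ?_
  · rw [key, Fintype.card_coe]
    rfl
  · intro x hx
    obtain ⟨d, hd, y, hy, rfl⟩ := hF.exists_eq hx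
    rcases mem_labelDigits_labelM9.1 hd with rfl | hd
    · exact Or.inl ⟨y, hy, rfl⟩
    · exact Or.inr ⟨⟨d, hd⟩, y, hy, rfl⟩
  · exact fun e => cell_subset (mem_of_mem_cornerDigits e.2)
  · exact fun e => isPreconnected_cell e
  · rintro ⟨e, he⟩
    exact ⟨digitMap e (fixPt (oppDigit e)),
      ⟨_, fixPt_mem_fractalF9 (oppDigit_mem_cornerDigits he), rfl⟩,
      fixPt e, ⟨_, fixPt_mem_fractalF9 he, digitMap_fixPt e⟩, (digitMap_fixPt_oppDigit e).symm⟩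
  · intro e
    exact isOpen_lt_and_lt (by fun_prop) (by fun_prop) (by fun_prop) (by fun_prop)
  · rintro ⟨d, hd⟩ ⟨e, he⟩ hne
    rw [Set.disjoint_left]
    rintro x ⟨h1, h2⟩ ⟨h3, h4⟩
    rw [mem_cornerDigits] at hd he
    rcases hd with rfl | rfl | rfl | rfl <;> rcases he with rfl | rfl | rfl | rfl <;>
      first | exact hne rfl | (norm_num at h1 h2 h3 h4; linarith)
  · rintro e x ⟨h1, h2⟩
    constructor <;> simp <;> linarith
  · rintro e ⟨h1, -⟩
    norm_num at h1
  · rintro ⟨e, he⟩ _ ⟨x, hx, rfl⟩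
    have h1 := hF.nonneg_zero hx
    have h2 := hF.nonneg_one hx
    have h3 := hF.le_one_zero hx
    have h4 := hF.le_one_one hx
    rw [mem_cornerDigits] at he
    rcases he with rfl | rfl | rfl | rfl <;> constructor <;> simp <;> linarith

/-- A corner of `F₉` is an end point. -/
lemma isPreconnected_diff_corner {c : Fin 3 × Fin 3} (hc : c ∈ cornerDigits) :
    IsPreconnected (fractalF9 \ {fixPt c}) := by
  have hF := isFractalSquare_fractalF9
  have hcD := mem_of_mem_cornerDigits hc
  have hR : otherCells c ⊆ fractalF9 \ {fixPt c} := by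
    intro x hx
    obtain ⟨e, he, hne, y, hy, rfl⟩ := exists_of_mem_otherCells hc hx
    refine ⟨hF.mapsTo he hy, fun h => ?_⟩
    rw [Set.mem_singleton_iff, ← digitMap_fixPt c] at h
    have := eq_port_of_digitMap_eq hcD he hne (fixPt_mem_fractalF9 hc) hy h.symm
    rw [port_corner hc] at this
    exact oppDigit_ne hc (fixPt_injective this).symm
  have heq : fractalF9 \ {fixPt c} = ⋃ k : ℕ, (digitMap c)^[k] '' otherCells c := by
    refine Set.Subset.antisymm ?_ (hF.iUnion_iterate_subset hcD hR)
    rintro x ⟨hx, hne⟩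
    obtain ⟨-, k, hk⟩ := hF.exists_mem_iterate (R := fun _ : Unit => otherCells c) (fun x hx => by
      obtain ⟨e, he, y, hy, rfl⟩ := hF.exists_eq hx
      by_cases h : e = c
      · exact Or.inl ⟨y, hy, by rw [h]⟩
      · exact Or.inr ⟨(), cell_subset_otherCells he h ⟨y, hy, rfl⟩⟩) hcD hx hne
    exact Set.mem_iUnion.2 ⟨k, hk⟩
  rw [heq]
  refine IsFractalSquare.isPreconnected_iUnion_iterate (isPreconnected_otherCells c) ?_
  have ho := oppDigit_mem_cornerDigits hc
  refine ⟨digitMap (1, 1) (fixPt c), Or.inl ⟨_, fixPt_mem_fractalF9 hc, rfl⟩,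
    fixPt (oppDigit c), ?_, digitMap_fixPt_oppDigit c⟩
  exact cell_subset_otherCells (mem_of_mem_cornerDigits ho) (oppDigit_ne hc)
    ⟨_, fixPt_mem_fractalF9 ho, digitMap_fixPt _⟩

/-- A point at which two first-level pieces of `F₉` touch is not a `3`-branch point. -/
lemma card_connectedComponents_port {d e : Fin 3 × Fin 3} (hd : d ∈ labelDigits labelM9)
    (he : e ∈ labelDigits labelM9) (hne : e ≠ d) :
    ENat.card (ConnectedComponents ↥(fractalF9 \ {digitMap d (port d e)})) ≠ 3 := by
  have hF := isFractalSquare_fractalF9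
  obtain ⟨c, hc, hpc⟩ : ∃ c ∈ cornerDigits,
      digitMap d (port d e) = digitMap ((1, 1) : Fin 3 × Fin 3) (fixPt c) := by
    rcases mem_labelDigits_labelM9.1 hd with rfl | hd
    · exact ⟨e, (mem_labelDigits_labelM9.1 he).resolve_left hne, by rw [port_center]⟩
    · exact ⟨d, hd, by rw [port_corner hd, digitMap_fixPt_oppDigit]⟩
  rw [hpc]
  have ho := oppDigit_mem_cornerDigits hc
  have hcD := mem_of_mem_cornerDigits hc
  refine card_connectedComponents_ne_three (A := digitMap c '' (fractalF9 \ {fixPt (oppDigit c)}))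
    (B := digitMap ((1, 1) : Fin 3 × Fin 3) '' (fractalF9 \ {fixPt c}) ∪
      ⋃ e ∈ {e | e ∈ cornerDigits ∧ e ≠ c}, digitMap e '' fractalF9) ?_ ?_ ?_ ?_ ?_
  · exact IsFractalSquare.isPreconnected_image (isPreconnected_diff_corner ho) _
  · refine isPreconnected_union_biUnion
      (IsFractalSquare.isPreconnected_image (isPreconnected_diff_corner hc) _)
      (fun e _ => isPreconnected_cell e) fun e he => ?_
    exact ⟨_, ⟨_, ⟨fixPt_mem_fractalF9 he.1, fun h => he.2 (fixPt_injective h)⟩, rfl⟩,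
      ⟨_, fixPt_mem_fractalF9 (oppDigit_mem_cornerDigits he.1), digitMap_fixPt_oppDigit e⟩⟩
  · rintro _ ⟨x, ⟨hx, hxne⟩, rfl⟩
    refine ⟨hF.mapsTo hcD hx, fun h => hxne ?_⟩
    rw [Set.mem_singleton_iff, ← digitMap_fixPt_oppDigit] at h
    exact digitMap_injective _ h
  · refine Set.union_subset ?_ (Set.iUnion₂_subset ?_)
    · rintro _ ⟨x, ⟨hx, hxne⟩, rfl⟩
      exact ⟨hF.mapsTo (by decide) hx, fun h => hxne (digitMap_injective _ h)⟩
    · rintro e ⟨he, hec⟩ _ ⟨x, hx, rfl⟩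
      refine ⟨hF.mapsTo (mem_of_mem_cornerDigits he) hx, fun h => hec ?_⟩
      have := eq_port_of_digitMap_eq (d := (1, 1)) (by decide) (mem_of_mem_cornerDigits he)
        (ne_center_of_mem_cornerDigits he) (fixPt_mem_fractalF9 hc) hx (Eq.symm h)
      rw [port_center] at this
      exact (fixPt_injective this).symm
  · rintro x ⟨hx, hxne⟩
    obtain ⟨e, he, y, hy, rfl⟩ := hF.exists_eq hx
    rcases mem_labelDigits_labelM9.1 he with rfl | he'
    · exact Or.inr (Or.inl ⟨y, ⟨hy, fun h => hxne (by rw [Set.mem_singleton_iff.1 h]; rfl)⟩, rfl⟩)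
    · by_cases hec : e = c
      · subst hec
        refine Or.inl ⟨y, ⟨hy, fun h => hxne ?_⟩, rfl⟩
        rw [Set.mem_singleton_iff.1 h, digitMap_fixPt_oppDigit]
        rfl
      · exact Or.inr (Or.inr (Set.mem_biUnion (show e ∈ {e | e ∈ cornerDigits ∧ e ≠ c} from
          ⟨he', hec⟩) ⟨y, hy, rfl⟩))

/-- The point `x` of `F₉`, seen as the point `digitMap d x`, is not a port of the piece of
digit `d`. -/
def NotPort (d : Fin 3 × Fin 3) (x : Plane) : Prop :=
  ∀ e ∈ labelDigits labelM9, e ≠ d → x ≠ port d e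

section NotPort

variable {d : Fin 3 × Fin 3} {x : Plane}

/-- A piece other than that of digit `d` is joined to its port without passing through a given
point of the piece of digit `d` other than that port. -/
lemma connIn_port {e : Fin 3 × Fin 3} (hd : d ∈ labelDigits labelM9) (hx : x ∈ fractalF9)
    (h : NotPort d x) (he : e ∈ labelDigits labelM9) (hne : e ≠ d) {y : Plane}
    (hy : y ∈ fractalF9) :
    ConnIn (fractalF9 \ {digitMap d x}) (digitMap e y) (digitMap d (port d e)) := by
  have havoid : ∀ e ∈ labelDigits labelM9, e ≠ d →
      ∀ y ∈ fractalF9, digitMap e y ∈ fractalF9 \ {digitMap d x} := fun e he hne y hy =>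
    ⟨isFractalSquare_fractalF9.mapsTo he hy, fun hxy =>
      h e he hne (eq_port_of_digitMap_eq hd he hne hx hy (Eq.symm hxy))⟩
  rcases mem_labelDigits_labelM9.1 hd with rfl | hd'
  · have he' := (mem_labelDigits_labelM9.1 he).resolve_left hne
    refine ⟨digitMap e '' fractalF9, ?_, isPreconnected_cell e, ⟨y, hy, rfl⟩, ?_⟩
    · rintro _ ⟨z, hz, rfl⟩
      exact havoid e he hne z hz
    · rw [port_center]
      exact ⟨_, fixPt_mem_fractalF9 (oppDigit_mem_cornerDigits he'), digitMap_fixPt_oppDigit e⟩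
  · refine ⟨otherCells d, ?_, isPreconnected_otherCells d,
      cell_subset_otherCells he hne ⟨y, hy, rfl⟩, ?_⟩
    · intro z hz
      obtain ⟨e, he, hne, y, hy, rfl⟩ := exists_of_mem_otherCells hd' hz
      exact havoid e he hne y hy
    · rw [port_corner hd', digitMap_fixPt_oppDigit]
      exact Or.inl ⟨_, fixPt_mem_fractalF9 hd', rfl⟩

lemma digitMap_mem_diff (hd : d ∈ labelDigits labelM9) {y : Plane} (hy : y ∈ fractalF9 \ {x}) :
    digitMap d y ∈ fractalF9 \ {digitMap d x} :=
  ⟨isFractalSquare_fractalF9.mapsTo hd hy.1, fun h => hy.2 (digitMap_injective d h)⟩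

lemma collapse_mem_diff (hd : d ∈ labelDigits labelM9) (h : NotPort d x) {u : Plane}
    (hu : u ∈ fractalF9 \ {digitMap d x}) : collapse d u ∈ fractalF9 \ {x} := by
  obtain ⟨hu, hne⟩ := hu
  obtain ⟨e, he, y, hy, rfl⟩ := isFractalSquare_fractalF9.exists_eq hu
  by_cases hed : e = d
  · subst hed
    rw [collapse_digitMap hd hy]
    exact ⟨hy, fun hyx => hne (by rw [Set.mem_singleton_iff.1 hyx]; rfl)⟩
  · rw [collapse_digitMap_of_ne hd he hed hy]
    obtain ⟨c, hc, hpc⟩ := exists_port_eq hd he hed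
    exact ⟨hpc ▸ fixPt_mem_fractalF9 hc, fun hp => h e he hed (Eq.symm hp)⟩

lemma connIn_digitMap_collapse (hd : d ∈ labelDigits labelM9) (hx : x ∈ fractalF9)
    (h : NotPort d x) {u : Plane} (hu : u ∈ fractalF9 \ {digitMap d x}) :
    ConnIn (fractalF9 \ {digitMap d x}) u (digitMap d (collapse d u)) := by
  obtain ⟨e, he, y, hy, rfl⟩ := isFractalSquare_fractalF9.exists_eq hu.1
  by_cases hed : e = d
  · subst hed
    rw [collapse_digitMap hd hy]
    exact ConnIn.refl hu
  · rw [collapse_digitMap_of_ne hd he hed hy]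
    exact connIn_port hd hx h he hed hy

lemma ConnIn.of_collapse (hd : d ∈ labelDigits labelM9) (hx : x ∈ fractalF9)
    (h : NotPort d x) {u v : Plane} (hu : u ∈ fractalF9 \ {digitMap d x})
    (hv : v ∈ fractalF9 \ {digitMap d x})
    (huv : ConnIn (fractalF9 \ {x}) (collapse d u) (collapse d v)) :
    ConnIn (fractalF9 \ {digitMap d x}) u v :=
  ((connIn_digitMap_collapse hd hx h hu).trans
    (huv.map (continuous_digitMap d).continuousOn fun _ hy => digitMap_mem_diff hd hy)).trans
    (connIn_digitMap_collapse hd hx h hv).symm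

/-- Away from the ports, `digitMap d` preserves the number of components of the complement of a
point: `collapse d` inverts it on components. -/
lemma card_connectedComponents_digitMap (hd : d ∈ labelDigits labelM9) (hx : x ∈ fractalF9)
    (h : NotPort d x) :
    ENat.card (ConnectedComponents ↥(fractalF9 \ {digitMap d x})) =
      ENat.card (ConnectedComponents ↥(fractalF9 \ {x})) := by
  let f : ↥(fractalF9 \ {x}) → ↥(fractalF9 \ {digitMap d x}) := fun y =>
    ⟨digitMap d y, digitMap_mem_diff hd y.2⟩
  have hf : Continuous f := by fun_prop
  refine (ENat.card_congr (Equiv.ofBijective hf.connectedComponentsMap ⟨?_, ?_⟩)).symm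
  · intro p q hpq
    obtain ⟨y, rfl⟩ := ConnectedComponents.surjective_coe p
    obtain ⟨z, rfl⟩ := ConnectedComponents.surjective_coe q
    have hpq' : ConnectedComponents.mk (f y) = ConnectedComponents.mk (f z) := hpq
    rw [ConnIn.mk_eq_mk_iff] at hpq' ⊢
    have := hpq'.map (continuous_collapse d).continuousOn fun _ hu => collapse_mem_diff hd h hu
    simpa only [f, collapse_digitMap hd y.2.1, collapse_digitMap hd z.2.1] using this
  · intro q
    obtain ⟨u, rfl⟩ := ConnectedComponents.surjective_coe q
    refine ⟨((⟨collapse d u, collapse_mem_diff hd h u.2⟩ : ↥(fractalF9 \ {x})) :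
      ConnectedComponents _), ?_⟩
    exact ConnIn.mk_eq_mk_iff.2 (connIn_digitMap_collapse hd hx h u.2).symm

end NotPort

/-- A `3`-branch point of `F₉` is the image of another one, which is not a port. -/
lemma exists_eq_digitMap_of_card_eq_three {a : Plane} (ha : a ∈ fractalF9)
    (h3 : ENat.card (ConnectedComponents ↥(fractalF9 \ {a})) = 3) :
    ∃ d ∈ labelDigits labelM9, ∃ x ∈ fractalF9, digitMap d x = a ∧ NotPort d x ∧
      ENat.card (ConnectedComponents ↥(fractalF9 \ {x})) = 3 := by
  obtain ⟨d, hd, x, hx, rfl⟩ := isFractalSquare_fractalF9.exists_eq ha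
  have hnp : NotPort d x := fun e he hne hp =>
    card_connectedComponents_port hd he hne (hp ▸ h3)
  exact ⟨d, hd, x, hx, rfl, hnp, by rw [← card_connectedComponents_digitMap hd hx hnp, h3]⟩

/-- The points `u`, `v`, `w` lie in three different components of `F₉ \ {a}`. -/
structure Separated (a u v w : Plane) : Prop where
  left_mem : u ∈ fractalF9 \ {a}
  mid_mem : v ∈ fractalF9 \ {a}
  right_mem : w ∈ fractalF9 \ {a}
  left_mid : ¬ ConnIn (fractalF9 \ {a}) u v
  left_right : ¬ ConnIn (fractalF9 \ {a}) u w
  mid_right : ¬ ConnIn (fractalF9 \ {a}) v w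

lemma Separated.collapse {d : Fin 3 × Fin 3} {x u v w : Plane} (hd : d ∈ labelDigits labelM9)
    (hx : x ∈ fractalF9) (h : NotPort d x) (hs : Separated (digitMap d x) u v w) :
    Separated x (collapse d u) (collapse d v) (collapse d w) where
  left_mem := collapse_mem_diff hd h hs.left_mem
  mid_mem := collapse_mem_diff hd h hs.mid_mem
  right_mem := collapse_mem_diff hd h hs.right_mem
  left_mid := fun hc => hs.left_mid (hc.of_collapse hd hx h hs.left_mem hs.mid_mem)
  left_right := fun hc => hs.left_right (hc.of_collapse hd hx h hs.left_mem hs.right_mem)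
  mid_right := fun hc => hs.mid_right (hc.of_collapse hd hx h hs.mid_mem hs.right_mem)

/-- The four corners of `F₉`. -/
def corners : Set Plane := fixPt '' cornerDigits

lemma collapse_mem_corners {d : Fin 3 × Fin 3} (hd : d ∈ labelDigits labelM9) {u : Plane}
    (hu : u ∈ corners) : collapse d u ∈ corners := by
  obtain ⟨e, he, rfl⟩ := hu
  have he := Finset.mem_coe.1 he
  rw [← digitMap_fixPt e]
  by_cases hed : e = d
  · subst hed
    rw [collapse_digitMap hd (fixPt_mem_fractalF9 he)]
    exact ⟨e, he, rfl⟩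
  · rw [collapse_digitMap_of_ne hd (mem_of_mem_cornerDigits he) hed (fixPt_mem_fractalF9 he)]
    obtain ⟨c, hc, hpc⟩ := exists_port_eq hd (mem_of_mem_cornerDigits he) hed
    exact ⟨c, hc, hpc.symm⟩

/-- If a point separates three corners of `F₉`, then it lies in the central piece: a corner piece
leaves at least two of the three corners in the connected union of the other pieces. -/
lemma Separated.eq_center {d : Fin 3 × Fin 3} {x u v w : Plane} (hd : d ∈ labelDigits labelM9)
    (hx : x ∈ fractalF9) (h : NotPort d x) (hs : Separated (digitMap d x) u v w)
    (hu : u ∈ corners) (hv : v ∈ corners) (hw : w ∈ corners) : d = (1, 1) := by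
  refine (mem_labelDigits_labelM9.1 hd).resolve_right fun hd' => ?_
  have hjoin : ∀ u ∈ corners, u ≠ fixPt d →
      ConnIn (fractalF9 \ {digitMap d x}) u (digitMap d (fixPt (oppDigit d))) := by
    rintro _ ⟨e, he, rfl⟩ hne
    have he := Finset.mem_coe.1 he
    have := connIn_port hd hx h (mem_of_mem_cornerDigits he) (fun hed => hne (by rw [hed]))
      (fixPt_mem_fractalF9 he)
    rwa [digitMap_fixPt, port_corner hd'] at this
  by_cases h1 : u = fixPt d
  · by_cases h2 : v = fixPt d
    · exact hs.left_mid (by rw [h1, h2]; exact ConnIn.refl (h1 ▸ hs.left_mem))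
    · by_cases h3 : w = fixPt d
      · exact hs.left_right (by rw [h1, h3]; exact ConnIn.refl (h1 ▸ hs.left_mem))
      · exact hs.mid_right ((hjoin v hv h2).trans (hjoin w hw h3).symm)
  · by_cases h2 : v = fixPt d
    · by_cases h3 : w = fixPt d
      · exact hs.mid_right (by rw [h2, h3]; exact ConnIn.refl (h2 ▸ hs.mid_mem))
      · exact hs.left_right ((hjoin u hu h1).trans (hjoin w hw h3).symm)
    · exact hs.left_mid ((hjoin u hu h1).trans (hjoin v hv h2).symm)

/-- A `3`-branch point that separates three corners would lie in all iterated central pieces, hence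
be the centre, which has four branches. -/
lemma not_separated_corners {a u v w : Plane} (ha : a ∈ fractalF9)
    (h3 : ENat.card (ConnectedComponents ↥(fractalF9 \ {a})) = 3) (hs : Separated a u v w)
    (hu : u ∈ corners) (hv : v ∈ corners) (hw : w ∈ corners) : False := by
  have hF := isFractalSquare_fractalF9
  have hdist : ∀ k : ℕ, dist a (fixPt (1, 1)) ≤ 2 / 3 ^ k := by
    intro k
    induction k generalizing a u v w with
    | zero => simpa using (hF.dist_lt_two ha (hF.fixPt_mem (by decide))).le
    | succ k ih =>
      obtain ⟨d, hd, x, hx, rfl, hnp, hx3⟩ := exists_eq_digitMap_of_card_eq_three ha h3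
      obtain rfl := hs.eq_center hd hx hnp hu hv hw
      have := ih hx hx3 (hs.collapse hd hx hnp) (collapse_mem_corners hd hu)
        (collapse_mem_corners hd hv) (collapse_mem_corners hd hw)
      rw [← digitMap_fixPt, dist_digitMap, pow_succ, ← div_div]
      linarith
  have ht : Filter.Tendsto (fun k : ℕ => (2 : ℝ) / 3 ^ k) Filter.atTop (𝓝 0) :=
    tendsto_const_nhds.div_atTop (tendsto_pow_atTop_atTop_of_one_lt (by norm_num))
  have hac : a = fixPt (1, 1) := dist_le_zero.1 (ge_of_tendsto' ht hdist)
  rw [hac, card_connectedComponents_center] at h3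
  exact absurd h3 (by norm_num)

/-- `F₉` has no `3`-branch point: while a point and `a` stay in the same piece, rescaling that piece
triples their distance, so that after finitely many steps every point outside `a` is collapsed to a
corner. -/
lemma not_isBranchPoint_fractalF9 (a : Plane) : ¬ IsBranchPoint 3 fractalF9 a := by
  have hF := isFractalSquare_fractalF9
  rintro ⟨ha, h3⟩
  have hfar : ∀ (k : ℕ) (a u v w : Plane), a ∈ fractalF9 →
      ENat.card (ConnectedComponents ↥(fractalF9 \ {a})) = 3 → Separated a u v w →
      (u ∈ corners ∨ 2 / 3 ^ k ≤ dist u a) → (v ∈ corners ∨ 2 / 3 ^ k ≤ dist v a) →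
      (w ∈ corners ∨ 2 / 3 ^ k ≤ dist w a) → False := by
    intro k
    induction k with
    | zero =>
      intro a u v w ha h3 hs hu hv hw
      have hcorner : ∀ u ∈ fractalF9 \ {a}, (u ∈ corners ∨ 2 / 3 ^ 0 ≤ dist u a) →
          u ∈ corners := fun u hu h => h.resolve_right fun h' => by
        have := hF.dist_lt_two hu.1 ha
        norm_num at h'
        linarith
      exact not_separated_corners ha h3 hs (hcorner u hs.left_mem hu) (hcorner v hs.mid_mem hv)
        (hcorner w hs.right_mem hw)
    | succ k ih =>
      intro a u v w ha h3 hs hu hv hw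
      obtain ⟨d, hd, x, hx, rfl, hnp, hx3⟩ := exists_eq_digitMap_of_card_eq_three ha h3
      have hstep : ∀ u ∈ fractalF9 \ {digitMap d x},
          (u ∈ corners ∨ 2 / 3 ^ (k + 1) ≤ dist u (digitMap d x)) →
          (collapse d u ∈ corners ∨ 2 / 3 ^ k ≤ dist (collapse d u) x) := by
        rintro u ⟨hu, -⟩ h
        rcases h with h | h
        · exact Or.inl (collapse_mem_corners hd h)
        obtain ⟨e, he, y, hy, rfl⟩ := hF.exists_eq hu
        by_cases hed : e = d
        · subst hed
          right
          rw [collapse_digitMap hd hy]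
          rw [dist_digitMap, pow_succ, ← div_div] at h
          linarith
        · left
          rw [collapse_digitMap_of_ne hd he hed hy]
          obtain ⟨c, hc, hpc⟩ := exists_port_eq hd he hed
          exact ⟨c, hc, hpc.symm⟩
      exact ih x _ _ _ hx hx3 (hs.collapse hd hx hnp) (hstep u hs.left_mem hu)
        (hstep v hs.mid_mem hv) (hstep w hs.right_mem hw)
  have h3' : ENat.card (ConnectedComponents ↥(fractalF9 \ {a})) = 3 := h3
  obtain ⟨u, hu, v, hv, w, hw, h1, h2, h4⟩ := exists_three_not_connIn h3'
  have hpos : ∀ u ∈ fractalF9 \ {a}, 0 < dist u a := fun u hu => dist_pos.2 hu.2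
  have ht : Filter.Tendsto (fun k : ℕ => (2 : ℝ) / 3 ^ k) Filter.atTop (𝓝 0) :=
    tendsto_const_nhds.div_atTop (tendsto_pow_atTop_atTop_of_one_lt (by norm_num))
  obtain ⟨k, hku, hkv, hkw⟩ := ((ht.eventually_lt_const (hpos u hu)).and
    ((ht.eventually_lt_const (hpos v hv)).and (ht.eventually_lt_const (hpos w hw)))).exists
  exact hfar k a u v w ha h3' ⟨hu, hv, hw, h1, h2, h4⟩ (Or.inr hku.le) (Or.inr hkv.le)
    (Or.inr hkw.le)

/-! ### Topological and Lipschitz invariance -/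

/-- A homeomorphism carries `k`-branch points to `k`-branch points. -/
lemma IsBranchPoint.of_homeomorph {k : ℕ} {E F : Set Plane} (g : E ≃ₜ F) {a : Plane}
    (h : IsBranchPoint k E a) : ∃ b, IsBranchPoint k F b := by
  obtain ⟨ha, hk⟩ := h
  let f : ↥(E \ {a}) ≃ₜ ↥(F \ {(g ⟨a, ha⟩ : Plane)}) :=
    { toFun := fun x => ⟨g ⟨x, x.2.1⟩, (g ⟨x, x.2.1⟩).2, fun h => x.2.2 (by
        have := g.injective (Subtype.ext h)
        exact congrArg Subtype.val this)⟩
      invFun := fun y => ⟨g.symm ⟨y, y.2.1⟩, (g.symm ⟨y, y.2.1⟩).2, fun h => y.2.2 (by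
        have : g.symm ⟨y, y.2.1⟩ = ⟨a, ha⟩ := Subtype.ext h
        exact congrArg Subtype.val ((g.symm_apply_eq).1 this))⟩
      left_inv := fun x => by simp
      right_inv := fun y => by simp
      continuous_toFun := by fun_prop
      continuous_invFun := by fun_prop }
  refine ⟨g ⟨a, ha⟩, (g ⟨a, ha⟩).2, ?_⟩
  rw [← hk]
  refine (ENat.card_congr (Equiv.ofBijective f.continuous.connectedComponentsMap ⟨?_, ?_⟩)).symm
  · intro p q hpq
    have h := congrArg f.symm.continuous.connectedComponentsMap hpq
    obtain ⟨x, rfl⟩ := ConnectedComponents.surjective_coe p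
    obtain ⟨y, rfl⟩ := ConnectedComponents.surjective_coe q
    change ConnectedComponents.mk (f.symm (f x)) = ConnectedComponents.mk (f.symm (f y)) at h
    simpa using h
  · intro q
    obtain ⟨y, rfl⟩ := ConnectedComponents.surjective_coe q
    refine ⟨(f.symm y : ConnectedComponents _), ?_⟩
    change ConnectedComponents.mk (f (f.symm y)) = ConnectedComponents.mk y
    rw [f.apply_symm_apply]

lemma LipschitzEquivalent.nonempty_homeomorph {E F : Set Plane} (h : LipschitzEquivalent E F) :
    Nonempty (E ≃ₜ F) := by
  obtain ⟨g, C, hC, hg⟩ := h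
  refine ⟨⟨g, ?_, ?_⟩⟩
  · exact (LipschitzWith.of_dist_le_mul (K := C.toNNReal) fun x y => by
      rw [Real.coe_toNNReal _ hC.le]; exact (hg x y).2).continuous
  · refine (LipschitzWith.of_dist_le_mul (K := C.toNNReal) fun x y => ?_).continuous
    have := (hg (g.symm x) (g.symm y)).1
    rw [Real.coe_toNNReal _ hC.le]
    rw [inv_mul_le_iff₀ hC] at this
    simpa using this

theorem mainTheorem7 :
    IsConnected fractalF6 ∧ IsConnected fractalF9 ∧
    (∃ a : Plane, IsBranchPoint 3 fractalF6 a) ∧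
    (¬ ∃ a : Plane, IsBranchPoint 3 fractalF9 a) ∧
    (¬ Nonempty (fractalF6 ≃ₜ fractalF9)) ∧
    ¬ LipschitzEquivalent fractalF6 fractalF9 := by
  have hno : ¬ ∃ a : Plane, IsBranchPoint 3 fractalF9 a := fun ⟨a, ha⟩ =>
    not_isBranchPoint_fractalF9 a ha
  have hhom : ¬ Nonempty (fractalF6 ≃ₜ fractalF9) := fun ⟨g⟩ =>
    hno (isBranchPoint_fractalF6.of_homeomorph g)
  exact ⟨isConnected_fractalF6, isConnected_fractalF9, ⟨_, isBranchPoint_fractalF6⟩, hno, hhom,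
    fun h => hhom h.nonempty_homeomorph⟩
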